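/- **Theorem 2.1.** Let $\theta=(\theta_{(1)},\dots,\theta_{(m)})$ be an $m$-group ordered grouping of parameters, with $\theta_{(i)}$ in a nonempty open set $\Theta_i\subseteq\mathbb R^{q_i}$, and let $\Theta=\Theta_1\times\cdots\times\Theta_m$. For every $\theta\in\Theta$ let $X_1,X_2,\dots$ be i.i.d. with density $f(x\mid\theta)$ (with respect to a fixed measure $dx$), where the family $f$ is regular: $f(x\mid\theta)$ is differentiable at each $\theta\in\Theta$ for almost every $x$, $\int \partial_\theta f(x\mid\theta)\,dx=0$, and the Fisher information matrix $\mathbf I(\theta)$ of $X_1$ is finite, positive definite and continuous in $\theta$. Let $N$ be a proper stopping time: $\{N\le n\}$ is determined by $X_1,\dots,X_n$, and $P_\theta(N<\infty)=1$. Suppose that for all $\theta\in\Theta$ $$\mathbf I(\theta)=\operatorname{diag}\Bigl(\prod_{i=1}^m \mathbf G_{1i}(\theta_{(i)}),\dots,\prod_{i=1}^m \mathbf G_{mi}(\theta_{(i)})\Bigr),$$ where $\mathbf G_{li}$ is a $q_l\times q_l$ matrix function of $\theta_{(i)}$ (matrix products taken in the order $i=1,\dots,m$), and that $$E_\theta(N)=\prod_{i=1}^m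 g_i(\theta_{(i)}),$$ where each $g_i>0$ is measurable and bounded on compact subsets of $\Theta_i$. For an experiment with Fisher information matrix $\mathbf J(\theta)$, the reference prior is defined by the Berger–Bernardo algorithm. For $\mathbf S=\mathbf J^{-1}$, let $\mathbf S_j$ be its upper left corner belonging to the groups $1,\dots,j$, and let $\mathbf h_j$ be the lower right $q_j\times q_j$ corner of $\mathbf S_j^{-1}$. Let $\Theta^1\subseteq\Theta^2\subseteq\cdots$ be rectangular compact sets, $\Theta^\ell=C_1^\ell\times\cdots\times C_m^\ell$, where, for each $i$, the sets $C_i^\ell$ are compact, increase with $\ell$ and have union $\Theta_i$. On $\Theta^\ell$ let the conditional density of $\theta_{(j)}$ given $\theta_{(1)},\dots,\theta_{(j-1)}$ be proportional, successively for $j=m,m-1,\dots,1$, to $$\exp\bigl\{\tfrac12 E^\ell_j[\log|\mathbf h_j(\theta)|\mid\theta_{(1)},\dots,\theta_{(j)}]\bigr\},$$ where $E_j^\ell$ is the expectation over $(\theta_{(j+1)},\dots,\theta_{(m)})$ under the conditional density already constructed (for $j=m$ the expression is $|\mathbf h_m(\theta)|^{1/2}$). With $\pi^\ell$ the product of these conditional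 densities, the reference prior is, up to a positive constant factor, $\lim_{\ell\to\infty}\pi^\ell(\theta)/\pi^\ell(\theta^*)$ for a fixed $\theta^*$. Then, for every such sequence $(\Theta^\ell)$, the reference priors below exist and are unique up to a positive constant factor. The reference prior based on the single observation $X_1$, i.e. for $\mathbf J=\mathbf I$, is $$\pi_R(\theta)\propto\prod_{i=1}^m|\mathbf G_{ii}(\theta_{(i)})|^{1/2},$$ where $|\mathbf G|$ denotes the absolute value of the determinant. The reference prior for the sequential experiment, i.e. with $\mathbf J$ the Fisher information matrix of $(X_1,\dots,X_N)$, is $$\pi_R^*(\theta)\propto\Bigl(\prod_{i=1}^m g_i(\theta_{(i)})^{q_i/2}\Bigr)\,\pi_R(\theta).$$ -/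

import Mathlib

open MeasureTheory ProbabilityTheory Filter Topology
open scoped ENNReal

noncomputable section

namespace SequentialReferencePrior

/-- The parameter vectors `θ = (θ_(1), …, θ_(m))`, the group `θ_(i)` having dimension `q i`. -/
abbrev Param {m : ℕ} (q : Fin m → ℕ) : Type := (i : Fin m) → Fin (q i) → ℝ

/-- The scalar coordinates of a parameter vector: `⟨i, a⟩` is the `a`-th coordinate of `θ_(i)`. -/
abbrev Coord {m : ℕ} (q : Fin m → ℕ) : Type := (i : Fin m) × Fin (q i)

/-! ### Scores and Fisher information -/

/-- The partial derivative of `F` at `θ` with respect to the scalar coordinate `p`. -/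
def partialDeriv {m : ℕ} {q : Fin m → ℕ} (F : Param q → ℝ) (θ : Param q) (p : Coord q) : ℝ :=
  fderiv ℝ F θ (Pi.single p.1 (Pi.single p.2 1))

/-- The score: partial derivatives of the log-likelihood for the likelihood `L θ s` of data `s`. -/
def score {m : ℕ} {q : Fin m → ℕ} {S : Type*} (L : Param q → S → ℝ)
    (θ : Param q) (p : Coord q) (s : S) : ℝ :=
  partialDeriv (fun t => Real.log (L t s)) θ p

/-- The Fisher information matrix `E_θ[score · scoreᵀ]` of an experiment with likelihood `L`,
whose data have (on the space `S`) the distribution `P θ`. -/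
def fisherInformation {m : ℕ} {q : Fin m → ℕ} {S : Type*} [MeasurableSpace S]
    (P : Param q → Measure S) (L : Param q → S → ℝ) (θ : Param q) :
    Matrix (Coord q) (Coord q) ℝ :=
  Matrix.of fun p r => ∫ s, score L θ p s * score L θ r s ∂(P θ)

/-- The distribution of one observation: density `f θ` with respect to `μ`. -/
def obsLaw {m : ℕ} {q : Fin m → ℕ} {𝒳 : Type*} [MeasurableSpace 𝒳] (μ : Measure 𝒳)
    (f : Param q → 𝒳 → ℝ) (θ : Param q) : Measure 𝒳 :=
  μ.withDensity fun x => ENNReal.ofReal (f θ x)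

/-- The Fisher information matrix of a single observation. -/
def singleInformation {m : ℕ} {q : Fin m → ℕ} {𝒳 : Type*} [MeasurableSpace 𝒳] (μ : Measure 𝒳)
    (f : Param q → 𝒳 → ℝ) (θ : Param q) : Matrix (Coord q) (Coord q) ℝ :=
  fisherInformation (obsLaw μ f) f θ

/-- A regular family of densities on the (open) parameter set `Θ`: probability densities,
differentiable in the parameter, with `∫ ∂f = 0` (differentiation of `∫ f = 1` under the
integral sign), and with finite, positive definite and continuous Fisher information. -/
structure IsRegularFamily {m : ℕ} {q : Fin m → ℕ} {𝒳 : Type*} [MeasurableSpace 𝒳]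
    (μ : Measure 𝒳) (Θ : Set (Param q)) (f : Param q → 𝒳 → ℝ) : Prop where
  measurable : ∀ θ ∈ Θ, Measurable (f θ)
  nonneg : ∀ θ ∈ Θ, ∀ x, 0 ≤ f θ x
  lintegral_eq_one : ∀ θ ∈ Θ, ∫⁻ x, ENNReal.ofReal (f θ x) ∂μ = 1
  differentiableAt : ∀ θ ∈ Θ, ∀ᵐ x ∂μ, DifferentiableAt ℝ (fun t => f t x) θ
  integral_partialDeriv : ∀ θ ∈ Θ, ∀ p, ∫ x, partialDeriv (fun t => f t x) θ p ∂μ = 0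
  score_memLp : ∀ θ ∈ Θ, ∀ p, MemLp (score f θ p) 2 (obsLaw μ f θ)
  posDef : ∀ θ ∈ Θ, (singleInformation μ f θ).PosDef
  continuousOn : ContinuousOn (singleInformation μ f) Θ

/-! ### The sequential experiment

The observations `X_1, X_2, …` are `X 0, X 1, …`. -/

/-- For every `θ ∈ Θ` the observations are i.i.d. under `P θ`, with density `f θ`. -/
structure IsIIDSample {m : ℕ} {q : Fin m → ℕ} {𝒳 Ω : Type*} [MeasurableSpace 𝒳]
    [MeasurableSpace Ω] (μ : Measure 𝒳) (Θ : Set (Param q)) (f : Param q → 𝒳 → ℝ)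
    (P : Param q → Measure Ω) (X : ℕ → Ω → 𝒳) : Prop where
  measurable : ∀ k, Measurable (X k)
  indep : ∀ θ ∈ Θ, iIndepFun X (P θ)
  law : ∀ θ ∈ Θ, ∀ k, (P θ).map (X k) = obsLaw μ f θ

/-- `N` is a proper stopping time: the event `N ≤ n` is determined by the first `n` observations
`X 0, …, X (n - 1)`, and `N` is almost surely finite for every parameter. -/
structure IsProperStoppingTime {m : ℕ} {q : Fin m → ℕ} {𝒳 Ω : Type*} [MeasurableSpace 𝒳]
    [MeasurableSpace Ω] (Θ : Set (Param q)) (P : Param q → Measure Ω) (X : ℕ → Ω → 𝒳)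
    (N : Ω → ℕ∞) : Prop where
  stopping : ∀ n : ℕ,
    MeasurableSet[⨆ k : Fin n, MeasurableSpace.comap (X k) inferInstance] {ω | N ω ≤ (n : ℕ∞)}
  proper : ∀ θ ∈ Θ, ∀ᵐ ω ∂(P θ), N ω ≠ ⊤

/-- The expected stopping time `E_θ(N)`. -/
def expectedStoppingTime {m : ℕ} {q : Fin m → ℕ} {Ω : Type*} [MeasurableSpace Ω]
    (P : Param q → Measure Ω) (N : Ω → ℕ∞) (θ : Param q) : ℝ≥0∞ :=
  ∫⁻ ω, (N ω : ℝ≥0∞) ∂(P θ)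

/-- The likelihood of the data `(X_1, …, X_N)` of the sequential experiment. -/
def sequentialLikelihood {m : ℕ} {q : Fin m → ℕ} {𝒳 Ω : Type*}
    (f : Param q → 𝒳 → ℝ) (X : ℕ → Ω → 𝒳) (N : Ω → ℕ∞) (θ : Param q) (ω : Ω) : ℝ :=
  ∏ k ∈ Finset.range (N ω).toNat, f θ (X k ω)

/-- The Fisher information matrix of the sequential experiment, i.e. of `(X_1, …, X_N)`. -/
def sequentialInformation {m : ℕ} {q : Fin m → ℕ} {𝒳 Ω : Type*} [MeasurableSpace Ω]
    (f : Param q → 𝒳 → ℝ) (P : Param q → Measure Ω) (X : ℕ → Ω → 𝒳) (N : Ω → ℕ∞)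
    (θ : Param q) : Matrix (Coord q) (Coord q) ℝ :=
  fisherInformation P (sequentialLikelihood f X N) θ

/-! ### The Berger–Bernardo reference prior for an ordered grouping -/

/-- The matrix `h_j` of the reference prior algorithm: with `S_j` the upper left corner of
`I⁻¹` belonging to the groups `1, …, j`, it is the lower right corner of `S_j⁻¹` belonging to
the group `j`. -/
def hBlock {m : ℕ} {q : Fin m → ℕ} (I : Matrix (Coord q) (Coord q) ℝ) (j : Fin m) :
    Matrix (Fin (q j)) (Fin (q j)) ℝ :=
  let S : Matrix {p : Coord q // p.1 ≤ j} {p : Coord q // p.1 ≤ j} ℝ :=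
    I⁻¹.submatrix Subtype.val Subtype.val
  S⁻¹.submatrix (fun a => ⟨⟨j, a⟩, le_rfl⟩) (fun a => ⟨⟨j, a⟩, le_rfl⟩)

/-- The groups after group `j`. -/
abbrev Tail {m : ℕ} (q : Fin m → ℕ) (j : Fin m) : Type :=
  (i : {i : Fin m // j < i}) → Fin (q i) → ℝ

/-- The parameter vector with groups `1, …, j` from `θ` and the later groups from `z`. -/
def glue {m : ℕ} {q : Fin m → ℕ} (j : Fin m) (θ : Param q) (z : Tail q j) : Param q :=
  fun i => if h : j < i then z ⟨i, h⟩ else θ i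

/-- The values of the group `j` which, together with the earlier groups of `θ`, can be completed
to a point of `K`. -/
def groupSection {m : ℕ} {q : Fin m → ℕ} (K : Set (Param q)) (j : Fin m) (θ : Param q) :
    Set (Fin (q j) → ℝ) :=
  {y | ∃ z : Tail q j, glue j (Function.update θ j y) z ∈ K}

/-- The values of the groups after `j` which complete the groups `1, …, j` of `θ` to a point
of `K`. -/
def tailSection {m : ℕ} {q : Fin m → ℕ} (K : Set (Param q)) (j : Fin m) (θ : Param q) :
    Set (Tail q j) :=
  {z | glue j θ z ∈ K}

/-- The integrand of `E_j[log |h_j| ∣ θ_(1), …, θ_(j)]`, where `ρ` is the conditional density of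
the groups after `j`. -/
def logIntegrand {m : ℕ} {q : Fin m → ℕ}
    (I : Param q → Matrix (Coord q) (Coord q) ℝ) (j : Fin m) (ρ : Param q → ℝ) (θ : Param q)
    (z : Tail q j) : ℝ :=
  Real.log (hBlock (I (glue j θ z)) j).det * ρ (glue j θ z)

/-- `exp {½ E_j[log |h_j| ∣ θ_(1), …, θ_(j)]}`. -/
def expFactor {m : ℕ} {q : Fin m → ℕ} (K : Set (Param q))
    (I : Param q → Matrix (Coord q) (Coord q) ℝ) (j : Fin m) (ρ : Param q → ℝ) (θ : Param q) :
    ℝ :=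
  Real.exp ((1 / 2) * ∫ z in tailSection K j θ, logIntegrand I j ρ θ z)

/-- The conditional densities of the reference prior algorithm on the compact set `K`:
`condDensity K I r θ` is the conditional density of the last `r` groups of `θ` given the earlier
ones. One passes from `r` to `r + 1` by adjoining the group `j` that precedes the last `r` groups,
with conditional density proportional to `exp {½ E_j[log |h_j| ∣ θ_(1), …, θ_(j)]}`; for the last
group there is no tail to average over, and this factor is `|h_m(θ)| ^ (1 / 2)`. -/
def condDensity {m : ℕ} {q : Fin m → ℕ} (K : Set (Param q))
    (I : Param q → Matrix (Coord q) (Coord q) ℝ) : ℕ → Param q → ℝ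
  | 0, _ => 1
  | r + 1, θ =>
    if hr : r < m then
      let j : Fin m := Fin.rev ⟨r, hr⟩
      let φ : (Fin (q j) → ℝ) → ℝ := fun y =>
        expFactor K I j (condDensity K I r) (Function.update θ j y)
      condDensity K I r θ *
        ((groupSection K j θ).indicator φ (θ j) / ∫ y in groupSection K j θ, φ y)
    else condDensity K I r θ

/-- The proper reference prior `π^ℓ` on the compact set `K = Θ^ℓ`. -/
def compactPrior {m : ℕ} {q : Fin m → ℕ} (K : Set (Param q))
    (I : Param q → Matrix (Coord q) (Coord q) ℝ) : Param q → ℝ :=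
  condDensity K I m

/-- All integrals in the algorithm on the compact set `K` converge, and the normalizing ones
are positive. -/
def AlgorithmWellPosed {m : ℕ} {q : Fin m → ℕ} (K : Set (Param q))
    (I : Param q → Matrix (Coord q) (Coord q) ℝ) : Prop :=
  ∀ (r : ℕ) (hr : r < m), ∀ θ ∈ K,
    let j : Fin m := Fin.rev ⟨r, hr⟩
    let φ : (Fin (q j) → ℝ) → ℝ := fun y =>
      expFactor K I j (condDensity K I r) (Function.update θ j y)
    IntegrableOn (logIntegrand I j (condDensity K I r) θ) (tailSection K j θ) ∧
      IntegrableOn φ (groupSection K j θ) ∧ 0 < ∫ y in groupSection K j θ, φ y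

/-- `π` is (a version of) the reference prior on `Θ` with respect to the ordered grouping and the
increasing sequence `K` of compact sets, for an experiment with Fisher information `I`: up to a
constant factor, `π θ = lim_ℓ π^ℓ(θ) / π^ℓ(θ₀)`, where `θ₀` is any fixed point at which the
`π^ℓ` are positive. -/
def IsReferencePrior {m : ℕ} {q : Fin m → ℕ} (Θ : Set (Param q)) (K : ℕ → Set (Param q))
    (I : Param q → Matrix (Coord q) (Coord q) ℝ) (π : Param q → ℝ) : Prop :=
  (∀ᶠ l in atTop, AlgorithmWellPosed (K l) I) ∧
  (∃ θ₀ ∈ Θ, ∀ᶠ l in atTop, 0 < compactPrior (K l) I θ₀) ∧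
  ∀ θ₀ ∈ Θ, (∀ᶠ l in atTop, 0 < compactPrior (K l) I θ₀) →
    ∃ c : ℝ, 0 < c ∧ ∀ θ ∈ Θ,
      Tendsto (fun l => compactPrior (K l) I θ / compactPrior (K l) I θ₀) atTop (𝓝 (c * π θ))

end SequentialReferencePrior

end

noncomputable section

namespace SequentialReferencePrior

/-! ### Wald's second identity -/

/-! The proof has two independent ingredients.

Statistics: the score of `(X_1, …, X_N)` is a stopped sum of i.i.d. centred score vectors, so Wald's
second identity (`wald_second`) gives the sequential information as `E_θ(N) • I(θ)`
(`sequentialInformation_eq`). Wald's identity is Hilbert space geometry: the terms `1{k < N} s(X_k)`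
are orthogonal in `L²`, with squared norms `P(k < N) E s²` that sum to `E(N) E s²`.

Algorithm: for a block diagonal matrix `h_j` is the `j`-th block, and here `log |h_j|` is a sum of
functions `L j i` of single groups (`SeparatesOn`). Averaging over the later groups turns their
terms into a constant, and normalizing over group `j` cancels both that constant and the terms of
the earlier groups. Only `exp(½ L j j)` survives, so `π^ℓ` is a product of one-group densities and
its ratios do not depend on `ℓ` once the box contains both points (`isReferencePrior_iff`).
Multiplying the information by `∏ g_i` multiplies `|h_j|` by `(∏ g_i)^{q_j}`; of this only
`g_j^{q_j}` survives, whence the exponent `q_j / 2`.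

The integrals converge because the `L j i` are bounded on compact sets. For `log g_i` this needs a
lower bound, which comes from `N ≥ 1`. -/

lemma summable_of_orthogonal {E : Type*} [NormedAddCommGroup E] [InnerProductSpace ℝ E]
    [CompleteSpace E] (y : ℕ → E) (horth : ∀ j k, j ≠ k → inner ℝ (y j) (y k) = 0)
    (hsum : Summable fun k => ‖y k‖ ^ 2) : Summable y := by
  -- The vectors need not be normalized and may vanish, so the orthogonal family consists of the
  -- lines they span.
  have hV : OrthogonalFamily ℝ (fun k => (Submodule.span ℝ {y k} : Submodule ℝ E))
      fun k => (Submodule.span ℝ {y k}).subtypeₗᵢ := by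
    intro j k hjk v w
    obtain ⟨a, ha⟩ := Submodule.mem_span_singleton.1 v.2
    obtain ⟨b, hb⟩ := Submodule.mem_span_singleton.1 w.2
    simp [← ha, ← hb, inner_smul_left, inner_smul_right, horth j k hjk]
  have := (hV.summable_iff_norm_sq_summable
    fun k => ⟨y k, Submodule.mem_span_singleton_self (y k)⟩).2 hsum
  exact this

/-- The almost sure sum of an orthogonal series with summable squared norms is its `L²` sum. -/
lemma exists_hasSum_toLp {Ω : Type*} [MeasurableSpace Ω] {P : Measure Ω}
    {Y : ℕ → Ω → ℝ} (hY : ∀ k, MemLp (Y k) 2 P)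
    (horth : ∀ j k, j ≠ k → ∫ ω, Y j ω * Y k ω ∂P = 0)
    (hsum : Summable fun k => ∫ ω, Y k ω * Y k ω ∂P) {S : Ω → ℝ}
    (hS : ∀ᵐ ω ∂P, Tendsto (fun n => ∑ k ∈ Finset.range n, Y k ω) atTop (𝓝 (S ω))) :
    ∃ F : Lp ℝ 2 P, HasSum (fun k => (hY k).toLp (Y k)) F ∧ F =ᵐ[P] S := by
  have hinner : ∀ j k, inner ℝ ((hY j).toLp (Y j)) ((hY k).toLp (Y k)) =
      ∫ ω, Y j ω * Y k ω ∂P := by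
    intro j k
    rw [L2.inner_def]
    refine integral_congr_ae ?_
    filter_upwards [(hY j).coeFn_toLp, (hY k).coeFn_toLp] with ω h1 h2
    simp [h1, h2, mul_comm]
  have hs : Summable fun k => (hY k).toLp (Y k) := by
    refine summable_of_orthogonal _ (fun j k h => by rw [hinner, horth j k h]) ?_
    simpa only [← real_inner_self_eq_norm_sq, hinner] using hsum
  refine ⟨_, hs.hasSum, ?_⟩
  have ht := hs.hasSum.tendsto_sum_nat
  rw [Lp.tendsto_Lp_iff_tendsto_eLpNorm'] at ht
  -- A subsequence of the `L²` partial sums converges almost surely, which identifies the `L²` limit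
  -- with `S`.
  obtain ⟨ns, hns, hlim⟩ := (tendstoInMeasure_of_tendsto_eLpNorm two_ne_zero
    (fun n => (Lp.aestronglyMeasurable _)) (Lp.aestronglyMeasurable _) ht).exists_seq_tendsto_ae
  have hfin : ∀ n, ((∑ k ∈ Finset.range n, (hY k).toLp (Y k) : Lp ℝ 2 P) : Ω → ℝ) =ᵐ[P]
      fun ω => ∑ k ∈ Finset.range n, Y k ω := by
    intro n
    induction n with
    | zero => simp only [Finset.range_zero, Finset.sum_empty]; exact Lp.coeFn_zero ℝ 2 P
    | succ n ih =>
      rw [Finset.sum_range_succ]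
      filter_upwards [ih, (hY n).coeFn_toLp, Lp.coeFn_add
        (∑ k ∈ Finset.range n, (hY k).toLp (Y k)) ((hY n).toLp (Y n))] with ω h1 h2 h3
      rw [h3, Pi.add_apply, h1, h2, Finset.sum_range_succ]
  filter_upwards [hlim, hS, ae_all_iff.2 hfin] with ω h1 h2 h3
  simp only [h3] at h1
  exact tendsto_nhds_unique h1 (h2.comp hns.tendsto_atTop)

/-- The inner product is continuous, and between partial sums only its diagonal terms are nonzero.
-/
lemma tendsto_sum_integral_mul {Ω : Type*} [MeasurableSpace Ω] {P : Measure Ω}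
    {Y Z : ℕ → Ω → ℝ} (hY : ∀ k, MemLp (Y k) 2 P) (hZ : ∀ k, MemLp (Z k) 2 P)
    (hYY : ∀ j k, j ≠ k → ∫ ω, Y j ω * Y k ω ∂P = 0)
    (hZZ : ∀ j k, j ≠ k → ∫ ω, Z j ω * Z k ω ∂P = 0)
    (hYZ : ∀ j k, j ≠ k → ∫ ω, Y j ω * Z k ω ∂P = 0)
    (hsY : Summable fun k => ∫ ω, Y k ω * Y k ω ∂P)
    (hsZ : Summable fun k => ∫ ω, Z k ω * Z k ω ∂P) {S T : Ω → ℝ}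
    (hS : ∀ᵐ ω ∂P, Tendsto (fun n => ∑ k ∈ Finset.range n, Y k ω) atTop (𝓝 (S ω)))
    (hT : ∀ᵐ ω ∂P, Tendsto (fun n => ∑ k ∈ Finset.range n, Z k ω) atTop (𝓝 (T ω))) :
    Tendsto (fun n => ∑ k ∈ Finset.range n, ∫ ω, Y k ω * Z k ω ∂P) atTop
      (𝓝 (∫ ω, S ω * T ω ∂P)) := by
  obtain ⟨F, hF, hFS⟩ := exists_hasSum_toLp hY hYY hsY hS
  obtain ⟨G, hG, hGT⟩ := exists_hasSum_toLp hZ hZZ hsZ hT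
  have hinner : ∀ j k, inner ℝ ((hY j).toLp (Y j)) ((hZ k).toLp (Z k)) =
      ∫ ω, Y j ω * Z k ω ∂P := by
    intro j k
    rw [L2.inner_def]
    refine integral_congr_ae ?_
    filter_upwards [(hY j).coeFn_toLp, (hZ k).coeFn_toLp] with ω h1 h2
    simp [h1, h2, mul_comm]
  have h := hF.tendsto_sum_nat.inner (𝕜 := ℝ) hG.tendsto_sum_nat
  have e : inner ℝ F G = ∫ ω, S ω * T ω ∂P := by
    rw [L2.inner_def]
    refine integral_congr_ae ?_
    filter_upwards [hFS, hGT] with ω h1 h2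
    simp [h1, h2, mul_comm]
  rw [e] at h
  refine h.congr fun n => ?_
  rw [sum_inner]
  refine Finset.sum_congr rfl fun k hk => ?_
  rw [inner_sum, Finset.sum_eq_single k]
  · exact hinner k k
  · intro j _ hj
    rw [hinner, hYZ k j hj.symm]
  · exact fun h => absurd hk h

/-- The event that the observation `n` is taken. -/
def continuing {Ω : Type*} (N : Ω → ℕ∞) (n : ℕ) : Set Ω := {ω | (n : ℕ∞) < N ω}

/-- Whether observation `n` is taken is decided by `X 0, …, X (n - 1)`; hence this event is
independent of `X n`. -/
lemma measurableSet_continuing {𝒳 Ω : Type*} [MeasurableSpace 𝒳] {X : ℕ → Ω → 𝒳} {N : Ω → ℕ∞}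
    (hN : ∀ n : ℕ, MeasurableSet[⨆ k : Fin n, MeasurableSpace.comap (X k) inferInstance]
      {ω | N ω ≤ (n : ℕ∞)}) (n : ℕ) :
    MeasurableSet[⨆ k : Fin n, MeasurableSpace.comap (X k) inferInstance] (continuing N n) := by
  have : continuing N n = {ω | N ω ≤ (n : ℕ∞)}ᶜ := by
    ext ω; simp [continuing]
  rw [this]
  exact (hN n).compl

section Stopping

variable {𝒳 Ω : Type*} [MeasurableSpace 𝒳] [mΩ : MeasurableSpace Ω]

lemma iSup_comap_le {X : ℕ → Ω → 𝒳} (hX : ∀ k, Measurable (X k)) (n : ℕ) :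
    (⨆ k : Fin n, MeasurableSpace.comap (X k) inferInstance) ≤ mΩ :=
  iSup_le fun k => (hX k).comap_le

lemma integral_past_mul {P : Measure Ω} {X : ℕ → Ω → 𝒳}
    (hX : ∀ k, Measurable (X k)) (hind : iIndepFun X P) (n : ℕ) {A : Ω → ℝ}
    (hA : Measurable[⨆ k : Fin n, MeasurableSpace.comap (X k) inferInstance] A)
    {s : 𝒳 → ℝ} (hs : Measurable s) :
    ∫ ω, A ω * s (X n ω) ∂P = (∫ ω, A ω ∂P) * ∫ ω, s (X n ω) ∂P := by
  have h1 := indep_iSup_of_disjoint (fun k => (hX k).comap_le) hind.iIndep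
    (S := {k | k < n}) (T := {n}) (by simp)
  have h2 : IndepFun A (fun ω => s (X n ω)) P := by
    rw [IndepFun_iff_Indep]
    refine indep_of_indep_of_le_left (indep_of_indep_of_le_right h1 ?_) ?_
    · simp only [Set.mem_singleton_iff, iSup_iSup_eq_left]
      have := (hs.comp (comap_measurable (X n)))
      exact this.comap_le
    · refine hA.comap_le.trans (iSup_le fun k => ?_)
      exact le_iSup₂_of_le (f := fun k (_ : k ∈ {k | k < n}) =>
        MeasurableSpace.comap (X k) inferInstance) k.1 k.2 le_rfl
  exact h2.integral_fun_mul_eq_mul_integral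
    (hA.mono (iSup_comap_le hX n) le_rfl).aestronglyMeasurable
    (hs.comp (hX n)).aestronglyMeasurable

lemma lintegral_eq_tsum_continuing {P : Measure Ω} {X : ℕ → Ω → 𝒳}
    (hX : ∀ k, Measurable (X k)) {N : Ω → ℕ∞}
    (hN : ∀ n : ℕ, MeasurableSet[⨆ k : Fin n, MeasurableSpace.comap (X k) inferInstance]
      {ω | N ω ≤ (n : ℕ∞)}) (hfin : ∀ᵐ ω ∂P, N ω ≠ ⊤) :
    ∫⁻ ω, (N ω : ℝ≥0∞) ∂P = ∑' n, P (continuing N n) := by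
  have hm : ∀ n, MeasurableSet (continuing N n) := fun n =>
    iSup_comap_le hX n _ (measurableSet_continuing hN n)
  have : ∀ n, P (continuing N n) = ∫⁻ ω, (continuing N n).indicator 1 ω ∂P := fun n => by
    rw [lintegral_indicator_one (hm n)]
  simp_rw [this]
  rw [← lintegral_tsum fun n => (measurable_one.indicator (hm n)).aemeasurable]
  refine lintegral_congr_ae ?_
  filter_upwards [hfin] with ω hω
  obtain ⟨k, hk⟩ := ENat.ne_top_iff_exists.1 hω
  rw [tsum_eq_sum (s := Finset.range k)]
  · rw [Finset.sum_congr rfl (g := fun _ => 1)]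
    · simp [← hk]
    · intro n hn
      have : ω ∈ continuing N n := by
        simpa [continuing, ← hk] using hn
      simp [this]
  · intro n hn
    have : ω ∉ continuing N n := by
      simpa [continuing, ← hk] using hn
    simp [this]

lemma wald_second_of_measurable {P : Measure Ω} [IsProbabilityMeasure P]
    {X : ℕ → Ω → 𝒳} {ν : Measure 𝒳}
    (hX : ∀ k, Measurable (X k)) (hind : iIndepFun X P) (hlaw : ∀ k, P.map (X k) = ν)
    {N : Ω → ℕ∞}
    (hN : ∀ n : ℕ, MeasurableSet[⨆ k : Fin n, MeasurableSpace.comap (X k) inferInstance]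
      {ω | N ω ≤ (n : ℕ∞)}) (hfin : ∀ᵐ ω ∂P, N ω ≠ ⊤)
    (hEN : ∫⁻ ω, (N ω : ℝ≥0∞) ∂P ≠ ⊤) {s t : 𝒳 → ℝ} (hsm : Measurable s) (htm : Measurable t)
    (hs : MemLp s 2 ν) (ht : MemLp t 2 ν) (hs0 : ∫ x, s x ∂ν = 0) (ht0 : ∫ x, t x ∂ν = 0) :
    ∫ ω, (∑ k ∈ Finset.range (N ω).toNat, s (X k ω)) *
        (∑ k ∈ Finset.range (N ω).toNat, t (X k ω)) ∂P =
      (∫⁻ ω, (N ω : ℝ≥0∞) ∂P).toReal * ∫ x, s x * t x ∂ν := by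
  have hm : ∀ n, MeasurableSet (continuing N n) := fun n =>
    iSup_comap_le hX n _ (measurableSet_continuing hN n)
  have hint : ∀ (u : 𝒳 → ℝ), Measurable u → ∀ k, ∫ ω, u (X k ω) ∂P = ∫ x, u x ∂ν := by
    intro u hu k
    rw [← hlaw k, integral_map (hX k).aemeasurable hu.aestronglyMeasurable]
  let Y : (𝒳 → ℝ) → ℕ → Ω → ℝ := fun u k => (continuing N k).indicator fun ω => u (X k ω)
  have hYL : ∀ u, MemLp u 2 ν → ∀ k, MemLp (Y u k) 2 P := by
    intro u hu k
    refine MemLp.indicator (hm k) ?_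
    rw [← hlaw k] at hu
    exact hu.comp_measurePreserving ⟨hX k, rfl⟩
  have hlt : ∀ u v, Measurable u → Measurable v → ∫ x, v x ∂ν = 0 → ∀ j k, j < k →
      ∫ ω, Y u j ω * Y v k ω ∂P = 0 := by
    intro u v hu hv hv0 j k hjk
    -- Everything except `v (X k ω)` is determined by the observations before `k`, so the centred
    -- factor splits off.
    have e : ∀ ω, Y u j ω * Y v k ω =
        (continuing N k).indicator ((continuing N j).indicator fun ω => u (X j ω)) ω
          * v (X k ω) := by
      intro ω
      by_cases h : ω ∈ continuing N k <;> simp [Y, h]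
    simp_rw [e]
    rw [integral_past_mul hX hind k _ hv, hint v hv, hv0, mul_zero]
    have hXm : Measurable[⨆ k : Fin k, MeasurableSpace.comap (X k) inferInstance] (X j) :=
      (comap_measurable (X j)).mono (le_iSup (fun i : Fin k =>
        MeasurableSpace.comap (X i) inferInstance) ⟨j, hjk⟩) le_rfl
    refine Measurable.indicator (Measurable.indicator (hu.comp hXm) ?_)
      (measurableSet_continuing hN k)
    refine (iSup_le fun i => ?_ : (⨆ k : Fin j, MeasurableSpace.comap (X k) inferInstance) ≤ _)
      _ (measurableSet_continuing hN j)
    exact le_iSup (fun i : Fin k => MeasurableSpace.comap (X i) inferInstance)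
      ⟨i, i.2.trans hjk⟩
  have hne : ∀ u v, Measurable u → Measurable v → ∫ x, u x ∂ν = 0 → ∫ x, v x ∂ν = 0 →
      ∀ j k, j ≠ k → ∫ ω, Y u j ω * Y v k ω ∂P = 0 := by
    intro u v hu hv hu0 hv0 j k hjk
    rcases lt_or_gt_of_ne hjk with h | h
    · exact hlt u v hu hv hv0 j k h
    · simp_rw [mul_comm (Y u j _)]
      exact hlt v u hv hu hu0 k j h
  have heq : ∀ u v, Measurable u → Measurable v → ∀ k,
      ∫ ω, Y u k ω * Y v k ω ∂P = (P (continuing N k)).toReal * ∫ x, u x * v x ∂ν := by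
    intro u v hu hv k
    have e : ∀ ω, Y u k ω * Y v k ω =
        (continuing N k).indicator (fun _ => (1 : ℝ)) ω * (fun x => u x * v x) (X k ω) := by
      intro ω
      by_cases h : ω ∈ continuing N k <;> simp [Y, h]
    rw [integral_congr_ae (ae_of_all _ e), integral_past_mul hX hind k (Measurable.indicator measurable_const
      (measurableSet_continuing hN k))
      (s := fun x => u x * v x) (hu.mul hv), hint (fun x => u x * v x) (hu.mul hv)]
    congr 1
    rw [integral_indicator_const _ (hm k)]
    simp [measureReal_def]
  have hts := lintegral_eq_tsum_continuing hX hN hfin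
  -- The tail sum formula for `E(N)`; it provides both the `L²` summability and the value of the
  -- limit.
  have hsumP : HasSum (fun k => (P (continuing N k)).toReal)
      (∫⁻ ω, (N ω : ℝ≥0∞) ∂P).toReal := by
    rw [hts] at hEN ⊢
    rw [ENNReal.tsum_toReal_eq fun n => measure_ne_top _ _]
    exact ENNReal.hasSum_toReal hEN
  have hlim : ∀ u : 𝒳 → ℝ, ∀ᵐ ω ∂P, Tendsto (fun n => ∑ k ∈ Finset.range n, Y u k ω) atTop
      (𝓝 (∑ k ∈ Finset.range (N ω).toNat, u (X k ω))) := by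
    intro u
    filter_upwards [hfin] with ω hω
    obtain ⟨k, hk⟩ := ENat.ne_top_iff_exists.1 hω
    refine tendsto_atTop_of_eventually_const (i₀ := k) fun n hn => ?_
    rw [← hk, ENat.toNat_natCast]
    symm
    refine Finset.sum_subset_zero_on_sdiff (Finset.range_mono hn) ?_ ?_
    · intro i hi
      have : ω ∉ continuing N i := by
        simp only [Finset.mem_sdiff, Finset.mem_range, not_lt] at hi
        simpa [continuing, ← hk] using hi.2
      simp [Y, this]
    · intro i hi
      have : ω ∈ continuing N i := by
        simpa [continuing, ← hk] using hi
      simp [Y, this]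
  have key := tendsto_sum_integral_mul (hYL s hs) (hYL t ht) (hne s s hsm hsm hs0 hs0)
    (hne t t htm htm ht0 ht0) (hne s t hsm htm hs0 ht0)
    (by simp_rw [heq s s hsm hsm]; exact hsumP.summable.mul_right _)
    (by simp_rw [heq t t htm htm]; exact hsumP.summable.mul_right _) (hlim s) (hlim t)
  simp_rw [heq s t hsm htm] at key
  exact tendsto_nhds_unique key ((hsumP.mul_right _).tendsto_sum_nat)

/-- **Wald's second identity** for two centred square integrable functions of the observations. -/
theorem wald_second {P : Measure Ω} [IsProbabilityMeasure P]
    {X : ℕ → Ω → 𝒳} {ν : Measure 𝒳}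
    (hX : ∀ k, Measurable (X k)) (hind : iIndepFun X P) (hlaw : ∀ k, P.map (X k) = ν)
    {N : Ω → ℕ∞}
    (hN : ∀ n : ℕ, MeasurableSet[⨆ k : Fin n, MeasurableSpace.comap (X k) inferInstance]
      {ω | N ω ≤ (n : ℕ∞)}) (hfin : ∀ᵐ ω ∂P, N ω ≠ ⊤)
    (hEN : ∫⁻ ω, (N ω : ℝ≥0∞) ∂P ≠ ⊤) {s t : 𝒳 → ℝ}
    (hs : MemLp s 2 ν) (ht : MemLp t 2 ν) (hs0 : ∫ x, s x ∂ν = 0) (ht0 : ∫ x, t x ∂ν = 0) :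
    ∫ ω, (∑ k ∈ Finset.range (N ω).toNat, s (X k ω)) *
        (∑ k ∈ Finset.range (N ω).toNat, t (X k ω)) ∂P =
      (∫⁻ ω, (N ω : ℝ≥0∞) ∂P).toReal * ∫ x, s x * t x ∂ν := by
  obtain ⟨s', hs'm, hs'⟩ := hs.1.aemeasurable
  obtain ⟨t', ht'm, ht'⟩ := ht.1.aemeasurable
  -- Countably many observations: the measurable versions agree with `s` and `t` at all of them
  -- simultaneously, almost surely.
  have hpull : ∀ u v : 𝒳 → ℝ, u =ᵐ[ν] v → ∀ᵐ ω ∂P, ∀ k, u (X k ω) = v (X k ω) := by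
    intro u v h
    refine ae_all_iff.2 fun k => ?_
    rw [← hlaw k] at h
    exact ae_of_ae_map (hX k).aemeasurable h
  have := wald_second_of_measurable hX hind hlaw hN hfin hEN hs'm ht'm
    ((memLp_congr_ae hs').1 hs) ((memLp_congr_ae ht').1 ht)
    (by rw [← hs0]; exact integral_congr_ae hs'.symm)
    (by rw [← ht0]; exact integral_congr_ae ht'.symm)
  have e : ∫ x, s x * t x ∂ν = ∫ x, s' x * t' x ∂ν := by
    refine integral_congr_ae ?_
    filter_upwards [hs', ht'] with x h1 h2
    rw [h1, h2]
  rw [e, ← this]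
  refine integral_congr_ae ?_
  filter_upwards [hpull _ _ hs', hpull _ _ ht'] with ω h1 h2
  simp only [h1, h2]

end Stopping

/-! ### The algorithm for information matrices with separating blocks -/

/-- For a block diagonal information matrix, `h_j` is the `j`-th diagonal block. -/
lemma hBlock_eq_of_blockDiagonal {m : ℕ} {q : Fin m → ℕ} (I : Matrix (Coord q) (Coord q) ℝ)
    (hI : ∀ p r : Coord q, p.1 ≠ r.1 → I p r = 0) (hdet : IsUnit I.det) (j : Fin m) :
    hBlock I j = I.submatrix (fun a => ⟨j, a⟩) (fun a => ⟨j, a⟩) := by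
  have h : (I⁻¹.submatrix Subtype.val Subtype.val :
      Matrix {p : Coord q // p.1 ≤ j} {p : Coord q // p.1 ≤ j} ℝ)⁻¹ =
      I.submatrix Subtype.val Subtype.val := by
    refine Matrix.inv_eq_right_inv ?_
    ext a b
    have h1 := congrFun (congrFun (Matrix.nonsing_inv_mul I hdet) a.1) b.1
    rw [Matrix.mul_apply] at h1
    rw [Matrix.mul_apply, Matrix.one_apply]
    simp only [Matrix.submatrix_apply]
    rw [Matrix.one_apply] at h1
    simp only [Subtype.ext_iff]
    -- In a column `b` of a group up to `j`, the entries of `I` in later groups vanish, so the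
    -- truncated product is the full one.
    rw [← h1, ← Finset.sum_filter_of_ne (p := fun p : Coord q => p.1 ≤ j)]
    · exact (Finset.sum_subtype (p := fun p : Coord q => p.1 ≤ j) _ (by simp)
        fun p => I⁻¹ a.1 p * I p b.1).symm
    · intro p _ hp
      by_contra hlt
      refine hp ?_
      rw [hI p b.1, mul_zero]
      intro he
      exact hlt (he ▸ b.2)
  unfold hBlock
  simp only [h]
  rfl

/-! ### Sections of a rectangular box. -/

lemma glue_mem_pi {m : ℕ} {q : Fin m → ℕ} {C : (i : Fin m) → Set (Fin (q i) → ℝ)} {j : Fin m}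
    {θ : Param q} {z : Tail q j} :
    glue j θ z ∈ Set.univ.pi C ↔ (∀ i, i ≤ j → θ i ∈ C i) ∧ ∀ i : {i // j < i}, z i ∈ C i := by
  constructor
  · intro h
    refine ⟨fun i hi => ?_, fun i => ?_⟩
    · simpa [glue, not_lt.2 hi] using h i trivial
    · simpa [glue, i.2] using h i.1 trivial
  · rintro ⟨h1, h2⟩ i -
    by_cases hi : j < i
    · simpa [glue, hi] using h2 ⟨i, hi⟩
    · simpa [glue, hi] using h1 i (not_lt.1 hi)

lemma groupSection_pi {m : ℕ} {q : Fin m → ℕ} {C : (i : Fin m) → Set (Fin (q i) → ℝ)}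
    {θ : Param q} (hθ : θ ∈ Set.univ.pi C) (j : Fin m) :
    groupSection (Set.univ.pi C) j θ = C j := by
  ext y
  simp only [groupSection, Set.mem_ofPred_eq, glue_mem_pi]
  constructor
  · rintro ⟨z, h, -⟩
    simpa using h j le_rfl
  · intro hy
    refine ⟨fun i => θ i.1, fun i hi => ?_, fun i => hθ i trivial⟩
    rcases eq_or_ne i j with rfl | h
    · simpa using hy
    · simpa [h] using hθ i trivial

lemma tailSection_pi {m : ℕ} {q : Fin m → ℕ} {C : (i : Fin m) → Set (Fin (q i) → ℝ)}
    {θ : Param q} (hθ : θ ∈ Set.univ.pi C) (j : Fin m) :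
    tailSection (Set.univ.pi C) j θ = Set.univ.pi fun i : {i // j < i} => C i := by
  ext z
  simp only [tailSection, Set.mem_ofPred_eq, glue_mem_pi]
  simp only [Set.mem_pi, Set.mem_univ, true_implies] at hθ ⊢
  simp [hθ]

/-- The determinants of the matrices `h_j` are on the compact box `∏ C i` products of functions
of the groups, given by their logarithms, which are measurable and bounded. -/
structure SeparatesOn {m : ℕ} {q : Fin m → ℕ} (C : (i : Fin m) → Set (Fin (q i) → ℝ))
    (I : Param q → Matrix (Coord q) (Coord q) ℝ)
    (L : (j i : Fin m) → (Fin (q i) → ℝ) → ℝ) : Prop where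
  log_det : ∀ θ ∈ Set.univ.pi C, ∀ j, Real.log (hBlock (I θ) j).det = ∑ i, L j i (θ i)
  measurableSet : ∀ i, MeasurableSet (C i)
  volume_pos : ∀ i, volume (C i) ≠ 0
  volume_lt_top : ∀ i, volume (C i) ≠ ⊤
  aestronglyMeasurable : ∀ j i, AEStronglyMeasurable (L j i) (volume.restrict (C i))
  bounded : ∀ j i, ∃ M, ∀ t ∈ C i, |L j i t| ≤ M

/-- The normalizing integral of the group `i`. -/
def groupMass {m : ℕ} {q : Fin m → ℕ} (C : (i : Fin m) → Set (Fin (q i) → ℝ))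
    (L : (j i : Fin m) → (Fin (q i) → ℝ) → ℝ) (i : Fin m) : ℝ :=
  ∫ t in C i, Real.exp ((1 / 2) * L i i t)

/-- The normalized density of the group `i`. -/
def groupDensity {m : ℕ} {q : Fin m → ℕ} (C : (i : Fin m) → Set (Fin (q i) → ℝ))
    (L : (j i : Fin m) → (Fin (q i) → ℝ) → ℝ) (i : Fin m) (t : Fin (q i) → ℝ) : ℝ :=
  Real.exp ((1 / 2) * L i i t) / groupMass C L i

namespace SeparatesOn

variable {m : ℕ} {q : Fin m → ℕ} {C : (i : Fin m) → Set (Fin (q i) → ℝ)}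
  {I : Param q → Matrix (Coord q) (Coord q) ℝ} {L : (j i : Fin m) → (Fin (q i) → ℝ) → ℝ}

lemma integrableOn_exp (h : SeparatesOn C I L) (i : Fin m) :
    IntegrableOn (fun t => Real.exp ((1 / 2) * L i i t)) (C i) := by
  obtain ⟨M, hM⟩ := h.bounded i i
  refine IntegrableOn.of_bound (h.volume_lt_top i).lt_top
    (Real.continuous_exp.comp_aestronglyMeasurable
      ((h.aestronglyMeasurable i i).const_mul _)) (Real.exp ((1 / 2) * M)) ?_
  refine (ae_restrict_iff' (h.measurableSet i)).2 (ae_of_all _ fun t ht => ?_)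
  rw [Real.norm_eq_abs, Real.abs_exp, Real.exp_le_exp]
  linarith [(abs_le.1 (hM t ht)).2]

lemma groupMass_pos (h : SeparatesOn C I L) (i : Fin m) : 0 < groupMass C L i := by
  have : NeZero (volume.restrict (C i)) := ⟨by simpa using h.volume_pos i⟩
  exact integral_exp_pos (h.integrableOn_exp i)

lemma groupDensity_pos (h : SeparatesOn C I L) (i : Fin m) (t : Fin (q i) → ℝ) :
    0 < groupDensity C L i t :=
  div_pos (Real.exp_pos _) (h.groupMass_pos i)

lemma integrableOn_groupDensity (h : SeparatesOn C I L) (i : Fin m) :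
    IntegrableOn (groupDensity C L i) (C i) :=
  (h.integrableOn_exp i).div_const _

lemma integral_groupDensity (h : SeparatesOn C I L) (i : Fin m) :
    ∫ t in C i, groupDensity C L i t = 1 := by
  simp only [groupDensity]
  rw [integral_div]
  exact div_self (h.groupMass_pos i).ne'

lemma volume_restrict_tail (j : Fin m) :
    (volume : Measure (Tail q j)).restrict (Set.univ.pi fun i : {i // j < i} => C i) =
      Measure.pi fun i : {i // j < i} => volume.restrict (C i) := by
  rw [volume_pi, Measure.restrict_pi_pi]

lemma integrableOn_tail (h : SeparatesOn C I L) (j : Fin m) :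
    IntegrableOn (fun z : Tail q j => ∏ i, groupDensity C L i.1 (z i))
      (Set.univ.pi fun i : {i // j < i} => C i) := by
  rw [IntegrableOn, volume_restrict_tail]
  exact Integrable.fintype_prod_dep (f := fun (i : {i // j < i}) t => groupDensity C L i.1 t)
    fun i => h.integrableOn_groupDensity i.1

lemma integral_tail (h : SeparatesOn C I L) (j : Fin m) :
    ∫ z in (Set.univ.pi fun i : {i // j < i} => C i : Set (Tail q j)),
      ∏ i, groupDensity C L i.1 (z i) = 1 := by
  rw [volume_restrict_tail, integral_fintype_prod_eq_prod
    (fun (i : {i // j < i}) t => groupDensity C L i.1 t)]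
  simp [h.integral_groupDensity]

lemma integrableOn_tail_sum_mul (h : SeparatesOn C I L) (j : Fin m) :
    IntegrableOn (fun z : Tail q j => (∑ i, L j i.1 (z i)) * ∏ i, groupDensity C L i.1 (z i))
      (Set.univ.pi fun i : {i // j < i} => C i) := by
  choose M hM using h.bounded j
  refine Integrable.bdd_mul (c := ∑ i : {i // j < i}, M i) (h.integrableOn_tail j) ?_ ?_
  · rw [volume_restrict_tail]
    refine Finset.aestronglyMeasurable_fun_sum _ fun i _ => ?_
    exact (h.aestronglyMeasurable j i.1).comp_quasiMeasurePreserving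
      (Measure.quasiMeasurePreserving_eval (fun i : {i // j < i} => volume.restrict (C i)) i)
  · refine (ae_restrict_iff' (MeasurableSet.univ_pi fun i => h.measurableSet i.1)).2
      (ae_of_all _ fun z hz => ?_)
    refine (norm_sum_le _ _).trans (Finset.sum_le_sum fun i _ => ?_)
    exact hM i.1 _ (hz i trivial)

/-- Splitting of the logarithm of `|h_j|` into the contributions of the groups up to `j` and of
the later ones. -/
lemma log_det_glue (h : SeparatesOn C I L) (j : Fin m) {θ : Param q} (hθ : θ ∈ Set.univ.pi C)
    {z : Tail q j} (hz : z ∈ Set.univ.pi fun i : {i // j < i} => C i) :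
    Real.log (hBlock (I (glue j θ z)) j).det =
      L j j (θ j) + ∑ i ∈ Finset.Iio j, L j i (θ i) + ∑ i, L j i.1 (z i) := by
  rw [h.log_det _ (glue_mem_pi.2 ⟨fun i _ => hθ i trivial, fun i => hz i trivial⟩),
    ← Finset.sum_filter_add_sum_filter_not Finset.univ (fun i => i ≤ j)]
  congr 1
  · have e : Finset.univ.filter (fun i => i ≤ j) = insert j (Finset.Iio j) := by
      ext i; simp [le_iff_eq_or_lt]
    rw [e, Finset.sum_insert (by simp)]
    congr 1
    · simp [glue]
    · refine Finset.sum_congr rfl fun i hi => ?_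
      simp [glue, (Finset.mem_Iio.1 hi).not_gt]
  · rw [Finset.sum_subtype (p := fun i => j < i) _ (by simp)]
    refine Finset.sum_congr rfl fun i _ => ?_
    simp [glue, i.2]

/-- The conditional density `ρ` of the groups after `j` is on the box the product of the normalized
group densities. -/
def TailDensity (C : (i : Fin m) → Set (Fin (q i) → ℝ))
    (L : (j i : Fin m) → (Fin (q i) → ℝ) → ℝ) (j : Fin m) (ρ : Param q → ℝ) : Prop :=
  ∀ θ ∈ Set.univ.pi C, ρ θ = ∏ i ∈ Finset.Ioi j, groupDensity C L i (θ i)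

/-- The first summand is a constant in `z` times a probability density; the second does not involve
`θ`. -/
lemma logIntegrand_eq (h : SeparatesOn C I L) {j : Fin m} {ρ : Param q → ℝ}
    (hρ : TailDensity C L j ρ) {θ : Param q} (hθ : θ ∈ Set.univ.pi C)
    {z : Tail q j} (hz : z ∈ Set.univ.pi fun i : {i // j < i} => C i) :
    logIntegrand I j ρ θ z =
      (L j j (θ j) + ∑ i ∈ Finset.Iio j, L j i (θ i)) * ∏ i, groupDensity C L i.1 (z i) +
        (∑ i, L j i.1 (z i)) * ∏ i, groupDensity C L i.1 (z i) := by
  rw [logIntegrand, h.log_det_glue j hθ hz,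
    hρ _ (glue_mem_pi.2 ⟨fun i _ => hθ i trivial, fun i => hz i trivial⟩), ← add_mul]
  congr 1
  rw [Finset.prod_subtype (p := fun i => j < i) _ (by simp)]
  refine Finset.prod_congr rfl fun i _ => ?_
  simp [glue, i.2]

lemma integrableOn_logIntegrand (h : SeparatesOn C I L) {j : Fin m} {ρ : Param q → ℝ}
    (hρ : TailDensity C L j ρ) {θ : Param q} (hθ : θ ∈ Set.univ.pi C) :
    IntegrableOn (logIntegrand I j ρ θ) (Set.univ.pi fun i : {i // j < i} => C i) := by
  refine IntegrableOn.congr_fun (((h.integrableOn_tail j).const_mul _).add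
    (h.integrableOn_tail_sum_mul j)) (fun z hz => (h.logIntegrand_eq hρ hθ hz).symm)
    (MeasurableSet.univ_pi fun i => h.measurableSet i.1)

/-- The factor of `expFactor` which does not depend on the group `j`. -/
def earlierFactor (C : (i : Fin m) → Set (Fin (q i) → ℝ))
    (L : (j i : Fin m) → (Fin (q i) → ℝ) → ℝ) (j : Fin m) (θ : Param q) : ℝ :=
  Real.exp ((1 / 2) * (∑ i ∈ Finset.Iio j, L j i (θ i) +
    ∫ z in (Set.univ.pi fun i : {i // j < i} => C i : Set (Tail q j)),
      (∑ i, L j i.1 (z i)) * ∏ i, groupDensity C L i.1 (z i)))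

lemma expFactor_eq (h : SeparatesOn C I L) {j : Fin m} {ρ : Param q → ℝ}
    (hρ : TailDensity C L j ρ) {θ : Param q} (hθ : θ ∈ Set.univ.pi C) :
    expFactor (Set.univ.pi C) I j ρ θ =
      Real.exp ((1 / 2) * L j j (θ j)) * earlierFactor C L j θ := by
  rw [expFactor, tailSection_pi hθ, earlierFactor, ← Real.exp_add]
  rw [setIntegral_congr_fun (MeasurableSet.univ_pi fun i => h.measurableSet i.1)
    fun z hz => h.logIntegrand_eq hρ hθ hz]
  rw [integral_add ((h.integrableOn_tail j).const_mul _) (h.integrableOn_tail_sum_mul j),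
    integral_const_mul, h.integral_tail]
  congr 1
  ring

lemma expFactor_update (h : SeparatesOn C I L) {j : Fin m} {ρ : Param q → ℝ}
    (hρ : TailDensity C L j ρ) {θ : Param q} (hθ : θ ∈ Set.univ.pi C)
    {y : Fin (q j) → ℝ} (hy : y ∈ C j) :
    expFactor (Set.univ.pi C) I j ρ (Function.update θ j y) =
      Real.exp ((1 / 2) * L j j y) * earlierFactor C L j θ := by
  have hmem : Function.update θ j y ∈ Set.univ.pi C := by
    intro i _
    rcases eq_or_ne i j with rfl | hij
    · simpa using hy
    · simpa [hij] using hθ i trivial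
  rw [h.expFactor_eq hρ hmem, Function.update_self]
  congr 1
  simp only [earlierFactor]
  congr 3
  refine Finset.sum_congr rfl fun i hi => ?_
  rw [Function.update_of_ne (Finset.mem_Iio.1 hi).ne]

lemma integrableOn_expFactor (h : SeparatesOn C I L) {j : Fin m} {ρ : Param q → ℝ}
    (hρ : TailDensity C L j ρ) {θ : Param q} (hθ : θ ∈ Set.univ.pi C) :
    IntegrableOn (fun y => expFactor (Set.univ.pi C) I j ρ (Function.update θ j y)) (C j) :=
  IntegrableOn.congr_fun ((h.integrableOn_exp j).mul_const (earlierFactor C L j θ))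
    (fun _ hy => (h.expFactor_update hρ hθ hy).symm) (h.measurableSet j)

lemma integral_expFactor (h : SeparatesOn C I L) {j : Fin m} {ρ : Param q → ℝ}
    (hρ : TailDensity C L j ρ) {θ : Param q} (hθ : θ ∈ Set.univ.pi C) :
    ∫ y in C j, expFactor (Set.univ.pi C) I j ρ (Function.update θ j y) =
      groupMass C L j * earlierFactor C L j θ := by
  rw [setIntegral_congr_fun (h.measurableSet j) fun y hy => h.expFactor_update hρ hθ hy,
    integral_mul_const]
  rfl

/-- `earlierFactor` occurs in both the numerator and the normalizing integral and cancels, which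
keeps the product form through the induction. The last `r` groups are written `m ≤ i.1 + r` to avoid
truncated subtraction. -/
lemma condDensity_eq (h : SeparatesOn C I L) (r : ℕ) (hr : r ≤ m) {θ : Param q}
    (hθ : θ ∈ Set.univ.pi C) :
    condDensity (Set.univ.pi C) I r θ =
      ∏ i ∈ Finset.univ.filter (fun i : Fin m => m ≤ i.1 + r), groupDensity C L i (θ i) := by
  induction r generalizing θ with
  | zero =>
    rw [Finset.filter_false_of_mem fun i _ => by simp]
    simp [condDensity]
  | succ r ih =>
    have hr' : r < m := hr
    set j : Fin m := Fin.rev ⟨r, hr'⟩ with hj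
    have hjv : j.1 = m - (r + 1) := by simp [hj, Fin.val_rev]
    have hρ : TailDensity C L j (condDensity (Set.univ.pi C) I r) := by
      intro θ hθ
      rw [ih hr'.le hθ]
      refine Finset.prod_congr ?_ fun _ _ => rfl
      ext i
      simp only [Finset.mem_filter, Finset.mem_univ, true_and, Finset.mem_Ioi, Fin.lt_def]
      omega
    rw [condDensity, dif_pos hr']
    simp only
    rw [← hj, groupSection_pi hθ, h.integral_expFactor hρ hθ,
      Set.indicator_of_mem (hθ j trivial), h.expFactor_update hρ hθ (hθ j trivial), hρ θ hθ]
    have e : Finset.univ.filter (fun i : Fin m => m ≤ i.1 + (r + 1)) =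
        insert j (Finset.Ioi j) := by
      ext i
      simp only [Finset.mem_filter, Finset.mem_univ, true_and, Finset.mem_insert,
        Finset.mem_Ioi, Fin.lt_def, Fin.ext_iff]
      omega
    rw [e, Finset.prod_insert (by simp), mul_comm]
    congr 1
    exact mul_div_mul_right _ _ (Real.exp_pos _).ne'

lemma tailDensity_condDensity (h : SeparatesOn C I L) {r : ℕ} (hr : r < m) :
    TailDensity C L (Fin.rev ⟨r, hr⟩) (condDensity (Set.univ.pi C) I r) := by
  intro θ hθ
  rw [h.condDensity_eq r hr.le hθ]
  refine Finset.prod_congr ?_ fun _ _ => rfl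
  ext i
  simp only [Finset.mem_filter, Finset.mem_univ, true_and, Finset.mem_Ioi, Fin.lt_def,
    Fin.val_rev]
  omega

lemma algorithmWellPosed (h : SeparatesOn C I L) : AlgorithmWellPosed (Set.univ.pi C) I := by
  intro r hr θ hθ
  have hρ := h.tailDensity_condDensity hr
  simp only
  rw [tailSection_pi hθ, groupSection_pi hθ]
  refine ⟨h.integrableOn_logIntegrand hρ hθ, h.integrableOn_expFactor hρ hθ, ?_⟩
  rw [h.integral_expFactor hρ hθ]
  exact mul_pos (h.groupMass_pos _) (Real.exp_pos _)

lemma compactPrior_eq (h : SeparatesOn C I L) {θ : Param q} (hθ : θ ∈ Set.univ.pi C) :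
    compactPrior (Set.univ.pi C) I θ = ∏ i, groupDensity C L i (θ i) := by
  rw [compactPrior, h.condDensity_eq m le_rfl hθ, Finset.filter_true_of_mem fun i _ => by simp]

lemma compactPrior_pos (h : SeparatesOn C I L) {θ : Param q} (hθ : θ ∈ Set.univ.pi C) :
    0 < compactPrior (Set.univ.pi C) I θ := by
  rw [h.compactPrior_eq hθ]
  exact Finset.prod_pos fun i _ => h.groupDensity_pos i _

/-- The box enters only through the group masses, and these cancel. -/
lemma compactPrior_div (h : SeparatesOn C I L) {θ θ₀ : Param q} (hθ : θ ∈ Set.univ.pi C)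
    (hθ₀ : θ₀ ∈ Set.univ.pi C) :
    compactPrior (Set.univ.pi C) I θ / compactPrior (Set.univ.pi C) I θ₀ =
      (∏ i, Real.exp ((1 / 2) * L i i (θ i))) / ∏ i, Real.exp ((1 / 2) * L i i (θ₀ i)) := by
  rw [h.compactPrior_eq hθ, h.compactPrior_eq hθ₀]
  simp only [groupDensity, Finset.prod_div_distrib]
  exact div_div_div_cancel_right₀ (Finset.prod_pos fun i _ => h.groupMass_pos i).ne' _ _

end SeparatesOn

/-- For separating information matrices the reference priors are the positive multiples of the
product of the diagonal factors. -/
theorem isReferencePrior_iff {m : ℕ} {q : Fin m → ℕ} {Θ : (i : Fin m) → Set (Fin (q i) → ℝ)}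
    (hΘ : ∀ i, (Θ i).Nonempty) {C : (i : Fin m) → ℕ → Set (Fin (q i) → ℝ)}
    (hC_mono : ∀ i, Monotone (C i)) (hC_union : ∀ i, ⋃ l, C i l = Θ i)
    {I : Param q → Matrix (Coord q) (Coord q) ℝ} {L : (j i : Fin m) → (Fin (q i) → ℝ) → ℝ}
    (h : ∀ᶠ l in atTop, SeparatesOn (fun i => C i l) I L) (π : Param q → ℝ) :
    IsReferencePrior (Set.univ.pi Θ) (fun l => Set.univ.pi fun i => C i l) I π ↔
      ∃ c : ℝ, 0 < c ∧ ∀ θ ∈ Set.univ.pi Θ, π θ = c * ∏ i, Real.exp ((1 / 2) * L i i (θ i)) := by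
  have hmem : ∀ θ ∈ Set.univ.pi Θ, ∀ᶠ l in atTop, θ ∈ Set.univ.pi fun i => C i l := by
    intro θ hθ
    simp only [Set.mem_pi, Set.mem_univ, true_implies] at hθ ⊢
    refine eventually_all.2 fun i => ?_
    have := hθ i
    rw [← hC_union i, Set.mem_iUnion] at this
    obtain ⟨l, hl⟩ := this
    filter_upwards [eventually_ge_atTop l] with k hk
    exact hC_mono i hk hl
  have hpos : ∀ θ ∈ Set.univ.pi Θ, ∀ᶠ l in atTop,
      0 < compactPrior (Set.univ.pi fun i => C i l) I θ := by
    intro θ hθ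
    filter_upwards [h, hmem θ hθ] with l hl hm
    exact hl.compactPrior_pos hm
  have hlim : ∀ θ ∈ Set.univ.pi Θ, ∀ θ₀ ∈ Set.univ.pi Θ,
      Tendsto (fun l => compactPrior (Set.univ.pi fun i => C i l) I θ /
        compactPrior (Set.univ.pi fun i => C i l) I θ₀) atTop
      (𝓝 ((∏ i, Real.exp ((1 / 2) * L i i (θ i))) /
        ∏ i, Real.exp ((1 / 2) * L i i (θ₀ i)))) := by
    intro θ hθ θ₀ hθ₀
    refine tendsto_const_nhds.congr' ?_
    filter_upwards [h, hmem θ hθ, hmem θ₀ hθ₀] with l hl hm hm₀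
    exact (hl.compactPrior_div hm hm₀).symm
  have hw : ∀ θ : Param q, 0 < ∏ i, Real.exp ((1 / 2) * L i i (θ i)) := fun θ =>
    Finset.prod_pos fun i _ => Real.exp_pos _
  constructor
  · rintro ⟨-, ⟨θ₀, hθ₀, hp⟩, H⟩
    obtain ⟨c, hc, hcl⟩ := H θ₀ hθ₀ hp
    -- With `w` the product of exponentials, uniqueness of limits gives `c * π θ = w θ / w θ₀`.
    refine ⟨(c * ∏ i, Real.exp ((1 / 2) * L i i (θ₀ i)))⁻¹, inv_pos.2 (mul_pos hc (hw θ₀)), ?_⟩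
    intro θ hθ
    have e := tendsto_nhds_unique (hcl θ hθ) (hlim θ hθ θ₀ hθ₀)
    rw [eq_div_iff (hw θ₀).ne'] at e
    rw [← e]
    field_simp [(hw θ₀).ne', hc.ne']
  · rintro ⟨c, hc, hπ⟩
    refine ⟨h.mono fun l hl => hl.algorithmWellPosed, ?_, ?_⟩
    · choose θ₀ hθ₀ using hΘ
      exact ⟨θ₀, fun i _ => hθ₀ i, hpos _ fun i _ => hθ₀ i⟩
    · intro θ₀ hθ₀ _
      refine ⟨(c * ∏ i, Real.exp ((1 / 2) * L i i (θ₀ i)))⁻¹,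
        inv_pos.2 (mul_pos hc (hw θ₀)), fun θ hθ => ?_⟩
      convert hlim θ hθ θ₀ hθ₀ using 2
      rw [hπ θ hθ]
      field_simp [(hw θ₀).ne', hc.ne']

/-! ### The information of the sequential experiment -/

/-- The score of the sequential experiment is the sum of the scores of the observations. -/
lemma score_sequentialLikelihood {m : ℕ} {q : Fin m → ℕ} {𝒳 Ω : Type*} {f : Param q → 𝒳 → ℝ} {X : ℕ → Ω → 𝒳} {N : Ω → ℕ∞}
    {θ : Param q} {ω : Ω}
    (h : ∀ k, DifferentiableAt ℝ (fun t => f t (X k ω)) θ ∧ 0 < f θ (X k ω)) (p : Coord q) :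
    score (sequentialLikelihood f X N) θ p ω =
      ∑ k ∈ Finset.range (N ω).toNat, score f θ p (X k ω) := by
  -- `Real.log` turns the product into a sum only for nonzero factors; continuity secures this near
  -- `θ`.
  have hev : ∀ᶠ t in 𝓝 θ, ∀ k ∈ Finset.range (N ω).toNat, f t (X k ω) ≠ 0 := by
    rw [Filter.eventually_all_finset]
    intro k _
    exact (h k).1.continuousAt.eventually_ne (h k).2.ne'
  have hlog : (fun t => Real.log (sequentialLikelihood f X N t ω)) =ᶠ[𝓝 θ]
      fun t => ∑ k ∈ Finset.range (N ω).toNat, Real.log (f t (X k ω)) := by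
    filter_upwards [hev] with t ht
    exact Real.log_prod ht
  rw [score, partialDeriv, hlog.fderiv_eq,
    fderiv_fun_sum fun k _ => (h k).1.log (h k).2.ne', sum_apply]
  rfl

section Information

variable {m : ℕ} {q : Fin m → ℕ} {𝒳 Ω : Type*} [MeasurableSpace 𝒳] [MeasurableSpace Ω]

namespace IsRegularFamily

variable {μ : Measure 𝒳} {Θ : Set (Param q)} {f : Param q → 𝒳 → ℝ}

lemma ae_obsLaw (hf : IsRegularFamily μ Θ f) {θ : Param q} (hθ : θ ∈ Θ) :
    ∀ᵐ x ∂(obsLaw μ f θ), DifferentiableAt ℝ (fun t => f t x) θ ∧ 0 < f θ x := by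
  rw [obsLaw, ae_withDensity_iff (hf.measurable θ hθ).ennreal_ofReal]
  filter_upwards [hf.differentiableAt θ hθ] with x hx h
  exact ⟨hx, by simpa using h⟩

/-- The score has expectation zero. -/
lemma integral_score (hf : IsRegularFamily μ Θ f) (hΘ : IsOpen Θ) {θ : Param q} (hθ : θ ∈ Θ)
    (p : Coord q) : ∫ x, score f θ p x ∂(obsLaw μ f θ) = 0 := by
  rw [obsLaw, integral_withDensity_eq_integral_toReal_smul
    (hf.measurable θ hθ).ennreal_ofReal (ae_of_all _ fun x => ENNReal.ofReal_lt_top),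
    ← hf.integral_partialDeriv θ hθ p]
  refine integral_congr_ae ?_
  filter_upwards [hf.differentiableAt θ hθ] with x hx
  rw [ENNReal.toReal_ofReal (hf.nonneg θ hθ x)]
  rcases (hf.nonneg θ hθ x).eq_or_lt with h0 | h0
  -- At a zero of the density the score is weighted by `0`; the derivative of `f` vanishes too,
  -- since nonnegativity on the open set makes `θ` a local minimum.
  · have hmin : IsLocalMin (fun t => f t x) θ := by
      filter_upwards [hΘ.mem_nhds hθ] with t ht
      rw [← h0]
      exact hf.nonneg t ht x
    simp [← h0, partialDeriv, hmin.fderiv_eq_zero]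
  · rw [score, partialDeriv, fderiv.log hx h0.ne', partialDeriv, smul_apply, smul_eq_mul,
      smul_eq_mul, mul_inv_cancel_left₀ h0.ne']

end IsRegularFamily

lemma sequentialInformation_eq {Θ : Set (Param q)} (hΘ : IsOpen Θ) {μ : Measure 𝒳}
    {f : Param q → 𝒳 → ℝ} (hf : IsRegularFamily μ Θ f) {P : Param q → Measure Ω}
    {X : ℕ → Ω → 𝒳} (hX : IsIIDSample μ Θ f P X) {N : Ω → ℕ∞}
    (hN : IsProperStoppingTime Θ P X N) {θ : Param q} (hθ : θ ∈ Θ)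
    (hfin : expectedStoppingTime P N θ ≠ ⊤) :
    sequentialInformation f P X N θ =
      (expectedStoppingTime P N θ).toReal • singleInformation μ f θ := by
  have := (hX.indep θ hθ).isProbabilityMeasure
  have hae : ∀ᵐ ω ∂(P θ), ∀ k, DifferentiableAt ℝ (fun t => f t (X k ω)) θ ∧
      0 < f θ (X k ω) := by
    refine ae_all_iff.2 fun k => ?_
    have := hf.ae_obsLaw hθ
    rw [← hX.law θ hθ k] at this
    exact ae_of_ae_map (hX.measurable k).aemeasurable this
  ext p r
  rw [Matrix.smul_apply, smul_eq_mul]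
  simp only [sequentialInformation, singleInformation, fisherInformation, Matrix.of_apply]
  rw [expectedStoppingTime, ← wald_second hX.measurable (hX.indep θ hθ) (hX.law θ hθ) hN.stopping
    (hN.proper θ hθ) hfin (hf.score_memLp θ hθ p) (hf.score_memLp θ hθ r)
    (hf.integral_score hΘ hθ p) (hf.integral_score hΘ hθ r)]
  refine integral_congr_ae ?_
  filter_upwards [hae] with ω hω
  rw [score_sequentialLikelihood hω, score_sequentialLikelihood hω]

/-- A stopping time with nonzero expectation is at least one. -/
lemma one_le_expectedStoppingTime {Θ : Set (Param q)} {P : Param q → Measure Ω}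
    {X : ℕ → Ω → 𝒳} {N : Ω → ℕ∞} (hN : IsProperStoppingTime Θ P X N) {θ : Param q}
    [IsProbabilityMeasure (P θ)] (h0 : expectedStoppingTime P N θ ≠ 0) :
    1 ≤ expectedStoppingTime P N θ := by
  have h := hN.stopping 0
  -- No observation precedes time `0`, so `{N ≤ 0}` lies in the trivial σ-algebra: it is empty or
  -- everything.
  rw [iSup_of_empty, MeasurableSpace.measurableSet_bot_iff] at h
  rcases h with h | h
  · have hge : ∀ ω, (1 : ℝ≥0∞) ≤ (N ω : ℝ≥0∞) := by
      intro ω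
      have h1 : ω ∉ {ω | N ω ≤ ((0 : ℕ) : ℕ∞)} := h ▸ Set.notMem_empty ω
      have : N ω ≠ 0 := by simpa using h1
      exact_mod_cast Order.one_le_iff_pos.2 (pos_iff_ne_zero.2 this)
    calc (1 : ℝ≥0∞) = ∫⁻ _, 1 ∂(P θ) := by simp
      _ ≤ _ := lintegral_mono hge
  · refine absurd ?_ h0
    have : ∀ ω, N ω = 0 := by
      intro ω
      have h1 : ω ∈ {ω | N ω ≤ ((0 : ℕ) : ℕ∞)} := h ▸ Set.mem_univ ω
      simpa using h1
    simp [expectedStoppingTime, this]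

end Information

/-! ### Separation of the determinants -/

section Separation

variable {m : ℕ} {q : Fin m → ℕ} {Θ : (i : Fin m) → Set (Fin (q i) → ℝ)}
  {I : Param q → Matrix (Coord q) (Coord q) ℝ}
  {G : (l i : Fin m) → (Fin (q i) → ℝ) → Matrix (Fin (q l)) (Fin (q l)) ℝ}

lemma update_mem_pi {θ : Param q} (hθ : θ ∈ Set.univ.pi Θ) {i : Fin m} {t : Fin (q i) → ℝ}
    (ht : t ∈ Θ i) : Function.update θ i t ∈ Set.univ.pi Θ := by
  intro k _
  rcases eq_or_ne k i with rfl | hk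
  · simpa using ht
  · simpa [hk] using hθ k trivial

/-- The contributions of the groups to the logarithm of the determinant of a diagonal block. -/
def logDet (G : (l i : Fin m) → (Fin (q i) → ℝ) → Matrix (Fin (q l)) (Fin (q l)) ℝ)
    (j i : Fin m) (t : Fin (q i) → ℝ) : ℝ :=
  Real.log (G j i t).det

variable (hpos : ∀ θ ∈ Set.univ.pi Θ, (I θ).PosDef)
  (hG : ∀ θ ∈ Set.univ.pi Θ, I θ =
    Matrix.blockDiagonal' fun l => (List.ofFn fun i => G l i (θ i)).prod)

include hG in
lemma block_eq {θ : Param q} (hθ : θ ∈ Set.univ.pi Θ) (j : Fin m) :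
    (I θ).submatrix (fun a => ⟨j, a⟩) (fun a => ⟨j, a⟩) =
      (List.ofFn fun i => G j i (θ i)).prod := by
  ext a b
  rw [hG θ hθ, Matrix.submatrix_apply, Matrix.blockDiagonal'_apply_eq]

include hG in
lemma det_block_eq {θ : Param q} (hθ : θ ∈ Set.univ.pi Θ) (j : Fin m) :
    ((I θ).submatrix (fun a => (⟨j, a⟩ : Coord q)) (fun a => ⟨j, a⟩)).det =
      ∏ i, (G j i (θ i)).det := by
  rw [block_eq hG hθ, ← Matrix.coe_detMonoidHom, map_list_prod, List.map_ofFn, List.prod_ofFn]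
  rfl

include hpos in
lemma det_block_pos {θ : Param q} (hθ : θ ∈ Set.univ.pi Θ) (j : Fin m) :
    0 < ((I θ).submatrix (fun a => (⟨j, a⟩ : Coord q)) (fun a => ⟨j, a⟩)).det :=
  ((hpos θ hθ).submatrix fun _ _ h => by simpa using h).det_pos

include hpos hG in
-- Only the product of the determinants is known to be positive. Single factors may be negative,
-- hence the absolute values in the result; `Real.log` ignores the sign.
lemma det_ne_zero {θ : Param q} (hθ : θ ∈ Set.univ.pi Θ) (j i : Fin m) :
    (G j i (θ i)).det ≠ 0 := by
  have h := (det_block_pos hpos hθ j).ne'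
  rw [det_block_eq hG hθ j] at h
  exact Finset.prod_ne_zero_iff.1 h i (Finset.mem_univ i)

include hpos hG in
lemma log_det_block {θ : Param q} (hθ : θ ∈ Set.univ.pi Θ) (j : Fin m) :
    Real.log ((I θ).submatrix (fun a => (⟨j, a⟩ : Coord q)) (fun a => ⟨j, a⟩)).det =
      ∑ i, logDet G j i (θ i) := by
  rw [det_block_eq hG hθ j, Real.log_prod fun i _ => det_ne_zero hpos hG hθ j i]
  rfl

include hpos hG in
lemma hBlock_smul {θ : Param q} (hθ : θ ∈ Set.univ.pi Θ) {c : ℝ} (hc : c ≠ 0) (j : Fin m) :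
    hBlock (c • I θ) j = c • (I θ).submatrix (fun a => ⟨j, a⟩) (fun a => ⟨j, a⟩) := by
  rw [hBlock_eq_of_blockDiagonal]
  · rfl
  · intro p r hpr
    rw [hG θ hθ, Matrix.smul_apply, Matrix.blockDiagonal'_apply, dif_neg hpr, smul_zero]
  · rw [Matrix.det_smul, isUnit_iff_ne_zero]
    exact mul_ne_zero (pow_ne_zero _ hc) (hpos θ hθ).det_pos.ne'

include hpos hG in
lemma log_det_hBlock_smul {θ : Param q} (hθ : θ ∈ Set.univ.pi Θ) {c : ℝ} (hc : c ≠ 0)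
    (j : Fin m) :
    Real.log (hBlock (c • I θ) j).det = q j * Real.log c + ∑ i, logDet G j i (θ i) := by
  rw [hBlock_smul hpos hG hθ hc, Matrix.det_smul, Fintype.card_fin,
    Real.log_mul (pow_ne_zero _ hc) (det_block_pos hpos hθ j).ne', Real.log_pow,
    log_det_block hpos hG hθ j]

include hpos hG in
-- No continuity of `G` is assumed. With the other groups frozen, `logDet G j i` differs by a
-- constant from the log-determinant of block `j` of `I`, which is continuous.
lemma continuousOn_logDet (hne : ∀ i, (Θ i).Nonempty) (hcont : ContinuousOn I (Set.univ.pi Θ))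
    (j i : Fin m) : ContinuousOn (logDet G j i) (Θ i) := by
  choose θ hθ' using hne
  have hθ : θ ∈ Set.univ.pi Θ := fun k _ => hθ' k
  have hup : ContinuousOn (fun t => I (Function.update θ i t)) (Θ i) :=
    hcont.comp ((continuous_const (y := θ)).update i continuous_id).continuousOn
      fun t ht => update_mem_pi hθ ht
  have hdet : ContinuousOn (fun t => Real.log ((I (Function.update θ i t)).submatrix
      (fun a => (⟨j, a⟩ : Coord q)) (fun a => ⟨j, a⟩)).det) (Θ i) := by
    refine ContinuousOn.log ?_ fun t ht => (det_block_pos hpos (update_mem_pi hθ ht) j).ne'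
    exact (Continuous.matrix_det (continuous_id.matrix_submatrix _ _)).comp_continuousOn hup
  refine (hdet.sub (continuousOn_const (c := ∑ k ∈ Finset.univ.erase i,
    logDet G j k (θ k)))).congr fun t ht => ?_
  rw [Pi.sub_apply, log_det_block hpos hG (update_mem_pi hθ ht),
    ← Finset.add_sum_erase _ _ (Finset.mem_univ i), Function.update_self,
    Finset.sum_congr rfl fun k hk => by rw [Function.update_of_ne (Finset.ne_of_mem_erase hk)]]
  ring

/-- Otherwise a nonempty open set would be a countable union of null sets. Early boxes may be null,
so the algorithm is well posed only from some `l` on. -/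
lemma eventually_volume_ne_zero (hopen : ∀ i, IsOpen (Θ i)) (hne : ∀ i, (Θ i).Nonempty)
    {C : (i : Fin m) → ℕ → Set (Fin (q i) → ℝ)} (hC_mono : ∀ i, Monotone (C i))
    (hC_union : ∀ i, ⋃ l, C i l = Θ i) : ∀ᶠ l in atTop, ∀ i, volume (C i l) ≠ 0 := by
  refine eventually_all.2 fun i => ?_
  have h : ∃ l, volume (C i l) ≠ 0 := by
    by_contra! h
    have h0 := measure_iUnion_null h
    rw [hC_union i] at h0
    exact ((hopen i).measure_pos volume (hne i)).ne' h0
  obtain ⟨l, hl⟩ := h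
  filter_upwards [eventually_ge_atTop l] with k hk h0
  exact hl (measure_mono_null (hC_mono i hk) h0)

include hpos hG in
-- Serves both experiments: `κ = 1` for a single observation, `κ = g` for the sequential one.
lemma eventually_separatesOn (hopen : ∀ i, IsOpen (Θ i)) (hne : ∀ i, (Θ i).Nonempty)
    {C : (i : Fin m) → ℕ → Set (Fin (q i) → ℝ)} (hC_compact : ∀ i l, IsCompact (C i l))
    (hC_mono : ∀ i, Monotone (C i)) (hC_union : ∀ i, ⋃ l, C i l = Θ i)
    (hcont : ContinuousOn I (Set.univ.pi Θ)) {J : Param q → Matrix (Coord q) (Coord q) ℝ}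
    {κ : (i : Fin m) → (Fin (q i) → ℝ) → ℝ} (hκ : ∀ i, ∀ t ∈ Θ i, 0 < κ i t)
    (hJ : ∀ θ ∈ Set.univ.pi Θ, J θ = (∏ i, κ i (θ i)) • I θ)
    (hκ_meas : ∀ i, AEMeasurable (κ i) (volume.restrict (Θ i)))
    (hκ_le : ∀ i l, ∃ M, ∀ t ∈ C i l, κ i t ≤ M)
    (hκ_ge : ∀ i, ∃ M, 0 < M ∧ ∀ t ∈ Θ i, M ≤ κ i t) :
    ∀ᶠ l in atTop, SeparatesOn (fun i => C i l) J
      fun j i t => q j * Real.log (κ i t) + logDet G j i t := by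
  have hsub : ∀ i l, C i l ⊆ Θ i := fun i l => hC_union i ▸ Set.subset_iUnion (C i) l
  filter_upwards [eventually_volume_ne_zero hopen hne hC_mono hC_union] with l hl
  refine ⟨fun θ hθ' j => ?_, fun i => (hC_compact i l).measurableSet, hl,
    fun i => (hC_compact i l).measure_lt_top.ne, fun j i => ?_, fun j i => ?_⟩
  · have hθ : θ ∈ Set.univ.pi Θ := fun i _ => hsub i l (hθ' i trivial)
    have hκ0 : ∀ i ∈ Finset.univ, κ i (θ i) ≠ 0 := fun i _ => (hκ i _ (hθ i trivial)).ne'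
    rw [hJ θ hθ, log_det_hBlock_smul hpos hG hθ (Finset.prod_ne_zero_iff.2 hκ0),
      Real.log_prod hκ0, Finset.mul_sum, ← Finset.sum_add_distrib]
  · refine AEStronglyMeasurable.add ?_ ?_
    · exact ((Real.measurable_log.comp_aemeasurable
        ((hκ_meas i).mono_measure (Measure.restrict_mono (hsub i l) le_rfl))).const_mul
          _).aestronglyMeasurable
    · exact ((continuousOn_logDet hpos hG hne hcont j i).mono
        (hsub i l)).aestronglyMeasurable (hC_compact i l).measurableSet
  · obtain ⟨A, hA⟩ := (hC_compact i l).exists_bound_of_continuousOn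
      ((continuousOn_logDet hpos hG hne hcont j i).mono (hsub i l))
    obtain ⟨M, hM⟩ := hκ_le i l
    obtain ⟨M', hM'0, hM'⟩ := hκ_ge i
    refine ⟨q j * max |Real.log M'| |Real.log M| + A, fun t ht => ?_⟩
    have h0 := hκ i t (hsub i l ht)
    refine (abs_add_le _ _).trans (add_le_add ?_ (hA t ht))
    rw [abs_mul, Nat.abs_cast]
    refine mul_le_mul_of_nonneg_left (abs_le_max_abs_abs ?_ ?_) (Nat.cast_nonneg _)
    · exact Real.log_le_log hM'0 (hM' t (hsub i l ht))
    · exact Real.log_le_log h0 (hM t ht)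

lemma exp_half_logDet {d : ℝ} (hd : d ≠ 0) :
    Real.exp ((1 / 2) * Real.log d) = |d| ^ (1 / 2 : ℝ) := by
  rw [Real.rpow_def_of_pos (abs_pos.2 hd), Real.log_abs, mul_comm]

end Separation

end SequentialReferencePrior

end

/-! ### The theorem. -/

open SequentialReferencePrior in
theorem theorem2p1 {m : ℕ} (q : Fin m → ℕ)
    {𝒳 Ω : Type*} [MeasurableSpace 𝒳] [MeasurableSpace Ω]
    -- the parameter space `∏ i, Θ i`
    (Θ : (i : Fin m) → Set (Fin (q i) → ℝ))
    (hΘ_open : ∀ i, IsOpen (Θ i)) (hΘ_nonempty : ∀ i, (Θ i).Nonempty)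
    -- the rectangular compact sets `∏ i, C i l`, increasing to the parameter space
    (C : (i : Fin m) → ℕ → Set (Fin (q i) → ℝ))
    (hC_compact : ∀ i l, IsCompact (C i l)) (hC_mono : ∀ i, Monotone (C i))
    (hC_union : ∀ i, ⋃ l, C i l = Θ i)
    -- the model, the i.i.d. observations and the stopping time
    (μ : MeasureTheory.Measure 𝒳) (f : SequentialReferencePrior.Param q → 𝒳 → ℝ)
    (hf : SequentialReferencePrior.IsRegularFamily μ (Set.univ.pi Θ) f)
    (P : SequentialReferencePrior.Param q → MeasureTheory.Measure Ω) (X : ℕ → Ω → 𝒳)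
    (hX : SequentialReferencePrior.IsIIDSample μ (Set.univ.pi Θ) f P X)
    (N : Ω → ℕ∞)
    (hN : SequentialReferencePrior.IsProperStoppingTime (Set.univ.pi Θ) P X N)
    -- the information of one observation is block diagonal with product blocks
    (G : (l i : Fin m) → (Fin (q i) → ℝ) → Matrix (Fin (q l)) (Fin (q l)) ℝ)
    (hG : ∀ θ ∈ Set.univ.pi Θ, SequentialReferencePrior.singleInformation μ f θ =
      Matrix.blockDiagonal' fun l => (List.ofFn fun i => G l i (θ i)).prod)
    -- the expected stopping time is a product, measurable and bounded on compact sets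
    (g : (i : Fin m) → (Fin (q i) → ℝ) → ℝ)
    (hg_pos : ∀ i, ∀ t ∈ Θ i, 0 < g i t)
    (hg_meas : ∀ i, Measurable ((Θ i).domRestrict (g i)))
    (hg_bdd : ∀ i, ∀ A ⊆ Θ i, IsCompact A → BddAbove (g i '' A))
    (hg : ∀ θ ∈ Set.univ.pi Θ, SequentialReferencePrior.expectedStoppingTime P N θ =
      ENNReal.ofReal (∏ i, g i (θ i))) :
    -- the reference prior based on a single observation
    (∀ πR : SequentialReferencePrior.Param q → ℝ,
      SequentialReferencePrior.IsReferencePrior (Set.univ.pi Θ)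
          (fun l => Set.univ.pi fun i => C i l)
          (SequentialReferencePrior.singleInformation μ f) πR ↔
        ∃ c : ℝ, 0 < c ∧ ∀ θ ∈ Set.univ.pi Θ,
          πR θ = c * ∏ i, |(G i i (θ i)).det| ^ (1 / 2 : ℝ)) ∧
    -- the reference prior for the sequential experiment
    (∀ πR πRs : SequentialReferencePrior.Param q → ℝ,
      SequentialReferencePrior.IsReferencePrior (Set.univ.pi Θ)
          (fun l => Set.univ.pi fun i => C i l)
          (SequentialReferencePrior.singleInformation μ f) πR →
        (SequentialReferencePrior.IsReferencePrior (Set.univ.pi Θ)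
            (fun l => Set.univ.pi fun i => C i l)
            (SequentialReferencePrior.sequentialInformation f P X N) πRs ↔
          ∃ c : ℝ, 0 < c ∧ ∀ θ ∈ Set.univ.pi Θ,
            πRs θ = c * ((∏ i, g i (θ i) ^ ((q i : ℝ) / 2)) * πR θ))) := by
  have hpos : ∀ θ ∈ Set.univ.pi Θ, (singleInformation μ f θ).PosDef := hf.posDef
  have hopen : IsOpen (Set.univ.pi Θ) := isOpen_set_pi Set.finite_univ fun i _ => hΘ_open i
  have hsub : ∀ i l, C i l ⊆ Θ i := fun i l => hC_union i ▸ Set.subset_iUnion (C i) l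
  have hgp : ∀ θ ∈ Set.univ.pi Θ, 0 < ∏ i, g i (θ i) := fun θ hθ =>
    Finset.prod_pos fun i _ => hg_pos i _ (hθ i trivial)
  have hgR : ∀ θ ∈ Set.univ.pi Θ, (expectedStoppingTime P N θ).toReal = ∏ i, g i (θ i) :=
    fun θ hθ => by rw [hg θ hθ, ENNReal.toReal_ofReal (hgp θ hθ).le]
  have hge1 : ∀ θ ∈ Set.univ.pi Θ, 1 ≤ ∏ i, g i (θ i) := by
    intro θ hθ
    have := (hX.indep θ hθ).isProbabilityMeasure
    have h1 := one_le_expectedStoppingTime hN (θ := θ)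
      (by rw [hg θ hθ]; simpa using hgp θ hθ)
    rw [hg θ hθ] at h1
    exact ENNReal.one_le_ofReal.1 h1
  have hsingle := isReferencePrior_iff hΘ_nonempty hC_mono hC_union
    (eventually_separatesOn hpos hG hΘ_open hΘ_nonempty hC_compact hC_mono hC_union
      hf.continuousOn (J := singleInformation μ f) (κ := fun _ _ => 1)
      (fun _ _ _ => one_pos) (fun θ _ => by simp) (fun _ => aemeasurable_const)
      (fun _ _ => ⟨1, fun _ _ => le_rfl⟩) (fun _ => ⟨1, one_pos, fun _ _ => le_rfl⟩))
  -- Freezing the other groups in `1 ≤ ∏ g_k` bounds `g i` below by the inverse of their product, so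
  -- `log g_i` is bounded on compact sets.
  have hlower : ∀ i, ∃ M, 0 < M ∧ ∀ t ∈ Θ i, M ≤ g i t := by
    intro i
    choose θ hθ' using hΘ_nonempty
    have hθ : θ ∈ Set.univ.pi Θ := fun k _ => hθ' k
    have hA : 0 < ∏ k ∈ Finset.univ.erase i, g k (θ k) :=
      Finset.prod_pos fun k _ => hg_pos k _ (hθ' k)
    refine ⟨(∏ k ∈ Finset.univ.erase i, g k (θ k))⁻¹, inv_pos.2 hA, fun t ht => ?_⟩
    have h1 := hge1 _ (update_mem_pi hθ ht)
    rw [← Finset.mul_prod_erase _ _ (Finset.mem_univ i), Function.update_self,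
      Finset.prod_congr rfl fun k hk => by
        rw [Function.update_of_ne (Finset.ne_of_mem_erase hk)]] at h1
    exact (inv_le_iff_one_le_mul₀ hA).2 h1
  have hseq := isReferencePrior_iff hΘ_nonempty hC_mono hC_union
    (eventually_separatesOn hpos hG hΘ_open hΘ_nonempty hC_compact hC_mono hC_union
      hf.continuousOn (J := sequentialInformation f P X N) (κ := g) hg_pos
      (fun θ hθ => by
        rw [sequentialInformation_eq hopen hf hX hN hθ (by rw [hg θ hθ]; exact ENNReal.ofReal_ne_top),
          hgR θ hθ])
      (fun i => aemeasurable_restrict_of_measurable_subtype (hΘ_open i).measurableSet (hg_meas i))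
      (fun i l => by
        obtain ⟨M, hM⟩ := hg_bdd i _ (hsub i l) (hC_compact i l)
        exact ⟨M, fun t ht => hM (Set.mem_image_of_mem _ ht)⟩) hlower)
  have hfac : ∀ θ ∈ Set.univ.pi Θ, ∀ i, Real.exp ((1 / 2) * logDet G i i (θ i)) =
      |(G i i (θ i)).det| ^ (1 / 2 : ℝ) := fun θ hθ i =>
    exp_half_logDet (det_ne_zero hpos hG hθ i i)
  have hfirst : ∀ πR : Param q → ℝ,
      IsReferencePrior (Set.univ.pi Θ) (fun l => Set.univ.pi fun i => C i l)
          (singleInformation μ f) πR ↔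
        ∃ c : ℝ, 0 < c ∧ ∀ θ ∈ Set.univ.pi Θ,
          πR θ = c * ∏ i, |(G i i (θ i)).det| ^ (1 / 2 : ℝ) := by
    intro πR
    rw [hsingle πR]
    refine exists_congr fun c => and_congr_right fun _ => forall₂_congr fun θ hθ => ?_
    simp only [Real.log_one, mul_zero, zero_add, hfac θ hθ]
  refine ⟨hfirst, fun πR πRs hR => ?_⟩
  obtain ⟨c₀, hc₀, hπR⟩ := (hfirst πR).1 hR
  rw [hseq πRs]
  -- `πR` is fixed only up to the factor `c₀`, which is absorbed into the constant.
  have hprod : ∀ θ ∈ Set.univ.pi Θ,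
      ∏ i, Real.exp ((1 / 2) * (q i * Real.log (g i (θ i)) + logDet G i i (θ i))) =
        c₀⁻¹ * ((∏ i, g i (θ i) ^ ((q i : ℝ) / 2)) * πR θ) := by
    intro θ hθ
    have e : ∀ i, Real.exp ((1 / 2) * (q i * Real.log (g i (θ i)) + logDet G i i (θ i))) =
        g i (θ i) ^ ((q i : ℝ) / 2) * |(G i i (θ i)).det| ^ (1 / 2 : ℝ) := by
      intro i
      rw [mul_add, Real.exp_add, hfac θ hθ, Real.rpow_def_of_pos (hg_pos i _ (hθ i trivial))]
      congr 2
      ring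
    simp_rw [e]
    rw [Finset.prod_mul_distrib, hπR θ hθ]
    field_simp
  constructor
  · rintro ⟨c, hc, h⟩
    refine ⟨c * c₀⁻¹, by positivity, fun θ hθ => ?_⟩
    rw [h θ hθ, hprod θ hθ]
    ring
  · rintro ⟨c, hc, h⟩
    refine ⟨c * c₀, by positivity, fun θ hθ => ?_⟩
    rw [h θ hθ, hprod θ hθ]
    field_simp
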